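/- Let $d\ge 2$ and $n,k\ge 0$ be integers. Put $\bar d=d$ if $d$ is odd and $\bar d=2d$ if $d$ is even, let $\zeta\in\mathbb{C}$ be a primitive $\bar d$-th root of unity, and put $\xi=\zeta^2$. Let $(v_i)_{i\in\mathbb{Z}/d}$ be the standard orthonormal basis of $\mathbb{C}^d$, and let $X,Z\in GL(\mathbb{C}^d)$ be given by $Xv_i=v_{i+1}$ and $Zv_i=\xi^i v_i$. For $m\ge 0$ let $\mathcal{P}_m=\mathcal{P}_m^{(d)}\subset GL((\mathbb{C}^d)^{\otimes m})$ be the Pauli group, generated by the operators $X_r$ and $Z_r$ ($1\le r\le m$), which act as $X$ and $Z$ on the $r$-th tensor factor and as the identity on the others, and by multiplication by $\zeta$; the space $(\mathbb{C}^d)^{\otimes m}$ carries the tensor product Hermitian inner product. Let $V=(\mathbb{C}^d)^{\otimes n}$ and let $H\subset\mathcal{P}_n$ be an abelian subgroup such that $H\cap\{\zeta^a \mid a\in\mathbb{Z}\}=\{I\}$ and $H\simeq(\mathbb{Z}/d)^k$. Let $V^H=\{v\in V \mid h(v)=v \text{ for all } h\in H\}$ and let $N(H)$ be the normaliser of $H$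 in $\mathcal{P}_n$; the group $N(H)/H$ acts on $V^H$. Then $k\le n$, and there are a unitary isomorphism $\theta\colon V^H\to(\mathbb{C}^d)^{\otimes(n-k)}$ and an isomorphism of groups $f\colon N(H)/H\to\mathcal{P}_{n-k}$ such that $\theta(g\cdot v)=f(g)(\theta(v))$ for all $g\in N(H)/H$ and $v\in V^H$. -/

import Mathlib

noncomputable section

namespace QuditPauli

open scoped TensorProduct ComplexConjugate

/-- `d` for odd `d`, and `2 * d` for even `d`. -/
def dbar (d : ℕ) : ℕ := if Odd d then d else 2 * d

/-- The one-qudit state space `ℂ^d`, with its standard orthonormal basis indexed by `ℤ/d`. -/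
abbrev Qudit (d : ℕ) : Type := EuclideanSpace ℂ (ZMod d)

/-- The standard basis `v_i`, `i ∈ ℤ/d`, of `ℂ^d`. -/
def stdBasis (d : ℕ) [NeZero d] : Module.Basis (ZMod d) ℂ (Qudit d) :=
  (EuclideanSpace.basisFun (ZMod d) ℂ).toBasis

/-- The shift operator `X` on `ℂ^d`: `X v_i = v_{i+1}`. -/
def opX (d : ℕ) [NeZero d] : Qudit d ≃ₗ[ℂ] Qudit d :=
  (stdBasis d).equiv (stdBasis d) (Equiv.addRight 1)

/-- The clock operator `Z` on `ℂ^d`: `Z v_i = (ζ ^ 2) ^ i v_i`, for `i = 0, …, d - 1`. -/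
def opZ (d : ℕ) [NeZero d] (ζ : ℂˣ) : Qudit d ≃ₗ[ℂ] Qudit d :=
  (stdBasis d).equiv ((stdBasis d).unitsSMul fun i => (ζ ^ 2) ^ i.val) (Equiv.refl _)

theorem opX_apply (d : ℕ) [NeZero d] (i : ZMod d) :
    opX d (stdBasis d i) = stdBasis d (i + 1) := by
  simp [opX]

theorem opZ_apply (d : ℕ) [NeZero d] (ζ : ℂˣ) (i : ZMod d) :
    opZ d ζ (stdBasis d i) = ((ζ : ℂ) ^ 2) ^ i.val • stdBasis d i := by
  simp [opZ, Module.Basis.unitsSMul_apply, Units.smul_def]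

/-- The `n`-qudit state space `(ℂ^d)^{⊗n}`. It is a type of its own, because it carries
the norm of the Hilbert space tensor product. -/
def QuditSpace (d n : ℕ) : Type := ⨂[ℂ] _ : Fin n, Qudit d

namespace QuditSpace

variable (d n : ℕ)

instance instACG : AddCommGroup (QuditSpace d n) :=
  inferInstanceAs (AddCommGroup (⨂[ℂ] _ : Fin n, Qudit d))

instance instMod : Module ℂ (QuditSpace d n) :=
  inferInstanceAs (Module ℂ (⨂[ℂ] _ : Fin n, Qudit d))

/-- The pure tensor `x_1 ⊗ … ⊗ x_n`, as a multilinear map. -/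
def pure : MultilinearMap ℂ (fun _ : Fin n => Qudit d) (QuditSpace d n) :=
  PiTensorProduct.tprod ℂ

variable [NeZero d]

/-- The computational basis `v_{i_1} ⊗ … ⊗ v_{i_n}` of `(ℂ^d)^{⊗n}`. -/
def compBasis : Module.Basis (Fin n → ZMod d) ℂ (QuditSpace d n) :=
  Basis.piTensorProduct fun _ : Fin n => stdBasis d

theorem compBasis_apply (p : Fin n → ZMod d) :
    compBasis d n p = pure d n fun r => stdBasis d (p r) :=
  Basis.piTensorProduct_apply _ p

/-- The inner product of `(ℂ^d)^{⊗n}` (conjugate linear in the first variable), for which the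
computational basis is orthonormal. -/
@[reducible] def core : InnerProductSpace.Core ℂ (QuditSpace d n) where
  inner u v := ∑ p, conj ((compBasis d n).repr u p) * (compBasis d n).repr v p
  conj_inner_symm u v := by simp [map_sum, mul_comm]
  re_inner_nonneg u := by
    rw [map_sum]
    refine Finset.sum_nonneg fun p _ => ?_
    rw [← Complex.normSq_eq_conj_mul_self]
    exact Complex.normSq_nonneg _
  add_left u v w := by simp [add_mul, Finset.sum_add_distrib]
  smul_left u v r := by simp [Finset.mul_sum, mul_assoc]
  definite u h := by
    have h1 : ∑ p, Complex.normSq ((compBasis d n).repr u p) = 0 := by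
      have h2 : ((∑ p, Complex.normSq ((compBasis d n).repr u p) : ℝ) : ℂ) = 0 := by
        rw [← h]
        push_cast
        exact Finset.sum_congr rfl fun p _ => Complex.normSq_eq_conj_mul_self
      exact_mod_cast h2
    rw [Finset.sum_eq_zero_iff_of_nonneg fun p _ => Complex.normSq_nonneg _] at h1
    refine (compBasis d n).ext_elem fun p => ?_
    simpa using h1 p (Finset.mem_univ p)

instance instNACG : NormedAddCommGroup (QuditSpace d n) :=
  (core d n).toNormedAddCommGroup

instance instIPS : InnerProductSpace ℂ (QuditSpace d n) :=
  InnerProductSpace.ofCore (core d n).toCore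

theorem inner_def (u v : QuditSpace d n) :
    inner ℂ u v = ∑ p, conj ((compBasis d n).repr u p) * (compBasis d n).repr v p := rfl

/-- The inner product is the one of the Hilbert space tensor product. -/
theorem inner_pure (x y : Fin n → Qudit d) :
    inner ℂ (pure d n x) (pure d n y) = ∏ r, inner ℂ (x r) (y r) := by
  have h (x : Fin n → Qudit d) (p : Fin n → ZMod d) :
      (compBasis d n).repr (pure d n x) p = ∏ r, x r (p r) :=
    Basis.piTensorProduct_repr_tprod_apply (fun _ : Fin n => stdBasis d) x p
  simp only [inner_def, h, PiLp.inner_apply, RCLike.inner_apply, map_prod,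
    ← Finset.prod_mul_distrib]
  rw [Finset.prod_univ_sum]
  simp [mul_comm]

end QuditSpace

/-- The operator `I ⊗ … ⊗ I ⊗ T ⊗ I ⊗ … ⊗ I`, with `T` in position `r`. -/
def onSite {d n : ℕ} (r : Fin n) (T : Qudit d ≃ₗ[ℂ] Qudit d) :
    QuditSpace d n ≃ₗ[ℂ] QuditSpace d n :=
  PiTensorProduct.congr fun s : Fin n => if s = r then T else LinearEquiv.refl ℂ (Qudit d)

/-- The operator of multiplication by `ζ` on `(ℂ^d)^{⊗n}`. -/
def opScalar (d n : ℕ) (ζ : ℂˣ) : QuditSpace d n ≃ₗ[ℂ] QuditSpace d n :=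
  LinearEquiv.smulOfUnit ζ

/-- The `n`-qudit Pauli group, a subgroup of `GL((ℂ^d)^{⊗n})` (the group of linear automorphisms):
it is generated by the `X_r`, the `Z_r` and the multiplication by `ζ`. -/
def pauliGroup (d n : ℕ) [NeZero d] (ζ : ℂˣ) :
    Subgroup (QuditSpace d n ≃ₗ[ℂ] QuditSpace d n) :=
  Subgroup.closure
    (Set.range (fun r : Fin n => onSite r (opX d)) ∪
      Set.range (fun r : Fin n => onSite r (opZ d ζ)) ∪ {opScalar d n ζ})

/-- The scalar `ζ` as an element of the Pauli group. -/
def pauliScalar (d n : ℕ) [NeZero d] (ζ : ℂˣ) : pauliGroup d n ζ :=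
  ⟨opScalar d n ζ, Subgroup.subset_closure (Or.inr rfl)⟩

section Stabiliser

variable {d n : ℕ} [NeZero d] {ζ : ℂˣ}

/-- The protected space `V^H = {v ∈ V | h v = v for all h ∈ H}`. -/
def fixedSpace (H : Subgroup (pauliGroup d n ζ)) : Submodule ℂ (QuditSpace d n) where
  carrier := {v | ∀ h ∈ H, h.1 v = v}
  zero_mem' h _ := map_zero h.1
  add_mem' hu hv h hh := by rw [map_add, hu h hh, hv h hh]
  smul_mem' c v hv h hh := by rw [map_smul, hv h hh]

theorem normalizer_preserves (H : Subgroup (pauliGroup d n ζ)) (g : pauliGroup d n ζ)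
    (hg : g ∈ Subgroup.normalizer (H : Set (pauliGroup d n ζ)))
    (v : QuditSpace d n) (hv : v ∈ fixedSpace H) : g.1 v ∈ fixedSpace H := by
  intro h hh
  have h1 : g⁻¹ * h * g ∈ H := by
    have h2 := (hg (g⁻¹ * h * g)).2
    simp only [SetLike.mem_coe] at h2
    exact h2 (by simpa [mul_assoc] using hh)
  have h3 : g.1 ((g⁻¹ * h * g).1 v) = h.1 (g.1 v) := by
    have h4 : g * (g⁻¹ * h * g) = h * g := by group
    exact congrArg (fun x : pauliGroup d n ζ => x.1 v) h4
  rw [← h3, hv _ h1]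

/-- The normaliser `N(H)` of `H` in the Pauli group, acting on `V^H`. -/
def normalizerAction (H : Subgroup (pauliGroup d n ζ)) :
    Representation ℂ (Subgroup.normalizer (H : Set (pauliGroup d n ζ))) (fixedSpace H) where
  toFun g := g.1.1.toLinearMap.restrict (normalizer_preserves H g.1 g.2)
  map_one' := rfl
  map_mul' _ _ := rfl

/-- The quotient group `N(H)/H`. -/
abbrev NormalizerQuotient (H : Subgroup (pauliGroup d n ζ)) : Type :=
  Subgroup.normalizer (H : Set (pauliGroup d n ζ)) ⧸
    H.subgroupOf (Subgroup.normalizer (H : Set (pauliGroup d n ζ)))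

/-- The action of `N(H)/H` on `V^H` induced by the action of `N(H)`. -/
def quotientAction (H : Subgroup (pauliGroup d n ζ)) :
    Representation ℂ (NormalizerQuotient H) (fixedSpace H) :=
  QuotientGroup.lift _ (normalizerAction H) fun g hg =>
    LinearMap.ext fun v => Subtype.ext (v.2 g.1 hg)

theorem quotientAction_mk (H : Subgroup (pauliGroup d n ζ))
    (g : Subgroup.normalizer (H : Set (pauliGroup d n ζ))) (v : fixedSpace H) :
    (quotientAction H (QuotientGroup.mk g) v : QuditSpace d n) = g.1.1 v := rfl

end Stabiliser

end QuditPauli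

end

noncomputable section

namespace QuditPauli

open scoped TensorProduct ComplexConjugate
open Module

/-! Up to a power of `ζ`, a Pauli operator is determined by its symbol in `(ℤ/d)^{2n}`, and two
Pauli operators commute up to `ξ` raised to the symplectic form of their symbols. The kernel of the
symbol map is the group of scalars, so `H` embeds as a free isotropic submodule with basis `e`.

Since `d` need not be prime, linear algebra over `ℤ/d` is replaced by duality and counting: `e` is
extended to an isotropic independent family of `n` symbols (`exists_isotropic_extension`), and the
new members receive isotropic dual partners orthogonal to `e` (`exists_symplectic_extension`).
Lifted to operators of order dividing `d`, the two new families are logical clocks and shifts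
commuting with `H`.

Averaging over a scalar-free group `G` gives `dim V^G = d^n / |G|` (`finrank_fixedSpace_mul_card`).
For `H` together with the clocks this dimension is 1; the shifts of a unit vector on that line form
an orthonormal basis of `V^H`, which `θ` matches with the computational basis. An element of `N(H)`
agrees on `V^H` with a logical Pauli operator up to a scalar. That scalar is a power of `ζ` because
Pauli operators have order dividing `dbar d`. Faithfulness of `N(H)/H` is again the dimension
formula (`mem_of_forall_apply_eq`). -/

/-- The monomial operator `v_p ↦ c χ(b ⬝ p) v_{p + a}`. -/
def weylOp {d n : ℕ} [NeZero d] (χ : AddChar (ZMod d) ℂˣ) (c : ℂˣ) (a b : Fin n → ZMod d) :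
    QuditSpace d n ≃ₗ[ℂ] QuditSpace d n :=
  (QuditSpace.compBasis d n).equiv
    ((QuditSpace.compBasis d n).unitsSMul fun p => c * χ (b ⬝ᵥ (p - a))) (Equiv.addRight a)

/-! ### Monomial operators: products, traces, unitarity -/

section Weyl

variable {d n : ℕ} [NeZero d] {χ : AddChar (ZMod d) ℂˣ} {c c' : ℂˣ} {a b a' b' : Fin n → ZMod d}

open QuditSpace

theorem weylOp_compBasis (p : Fin n → ZMod d) :
    weylOp χ c a b (compBasis d n p) = ((c * χ (b ⬝ᵥ p) : ℂˣ) : ℂ) • compBasis d n (p + a) := by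
  simp [weylOp, Basis.unitsSMul_apply, Units.smul_def]

theorem linearEquiv_ext_compBasis {M : Type*} [AddCommGroup M] [Module ℂ M]
    {f g : QuditSpace d n ≃ₗ[ℂ] M}
    (h : ∀ p, f (compBasis d n p) = g (compBasis d n p)) : f = g :=
  LinearEquiv.toLinearMap_injective ((compBasis d n).ext h)

theorem weylOp_mul :
    weylOp χ c a b * weylOp χ c' a' b' = weylOp χ (c * c' * χ (b ⬝ᵥ a')) (a + a') (b + b') := by
  refine linearEquiv_ext_compBasis fun p => ?_
  rw [LinearEquiv.mul_apply, weylOp_compBasis, map_smul, weylOp_compBasis, weylOp_compBasis,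
    smul_smul, ← Units.val_mul]
  congr 1
  · simp only [dotProduct_add, add_dotProduct, AddChar.map_add_eq_mul, Units.val_mul]
    ring
  · congr 1; abel

theorem weylOp_zero : weylOp χ c (0 : Fin n → ZMod d) 0 = opScalar d n c := by
  refine linearEquiv_ext_compBasis fun p => ?_
  rw [weylOp_compBasis]
  simp [opScalar, LinearEquiv.smulOfUnit, DistribMulAction.toLinearEquiv, Units.smul_def]

theorem weylOp_one : weylOp χ 1 (0 : Fin n → ZMod d) 0 = 1 := by
  rw [weylOp_zero]
  refine LinearEquiv.ext fun v => ?_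
  simp [opScalar, LinearEquiv.smulOfUnit]

/-- The image of `v_0` reveals `a` and `c`; the unit vectors then reveal `b`, since `χ` is faithful.
-/
theorem weylOp_injective (hχ : ∀ x, χ x = 1 → x = 0)
    (h : weylOp χ c a b = weylOp χ c' a' b') : c = c' ∧ a = a' ∧ b = b' := by
  have h1 (p) := congrArg (fun f => (compBasis d n).repr (f (compBasis d n p))) h
  simp only [weylOp_compBasis, map_smul, Basis.repr_self] at h1
  have ha : a = a' := by
    have h2 := DFunLike.congr_fun (h1 0) (0 + a)
    by_contra hne
    simp [Ne.symm hne] at h2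
  subst ha
  have h3 (p) : c * χ (b ⬝ᵥ p) = c' * χ (b' ⬝ᵥ p) := by
    have h2 := DFunLike.congr_fun (h1 p) (p + a)
    simp only [Finsupp.smul_apply, Finsupp.single_eq_same, smul_eq_mul, mul_one] at h2
    exact Units.ext h2
  have hc : c = c' := by simpa using h3 0
  subst hc
  refine ⟨rfl, rfl, funext fun r => ?_⟩
  have h4 := mul_left_cancel (h3 (Pi.single r 1))
  simp only [dotProduct_single, mul_one] at h4
  rw [← sub_eq_zero]
  apply hχ
  rw [AddChar.map_sub_eq_div, h4, div_self']

/-- For `a ≠ 0` the matrix has zero diagonal. For `a = 0` the trace is a multiple of the sum of a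
nontrivial character. -/
theorem trace_weylOp (hχ : ∀ x, χ x = 1 → x = 0) (h : (a, b) ≠ 0) :
    LinearMap.trace ℂ _ (weylOp χ c a b).toLinearMap = 0 := by
  rw [LinearMap.trace_eq_matrix_trace ℂ (compBasis d n), Matrix.trace]
  simp only [Matrix.diag_apply, LinearMap.toMatrix_apply, LinearEquiv.coe_coe, weylOp_compBasis,
    map_smul, Basis.repr_self, Finsupp.smul_apply, Finsupp.single_apply, smul_eq_mul]
  by_cases ha : a = 0
  · have hb : b ≠ 0 := fun hb => h (by rw [ha, hb]; rfl)
    let ψ : AddChar (Fin n → ZMod d) ℂ :=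
      { toFun := fun p => (χ (b ⬝ᵥ p) : ℂˣ)
        map_zero_eq_one' := by simp
        map_add_eq_mul' := fun p q => by simp [dotProduct_add, AddChar.map_add_eq_mul] }
    have hψ : ψ ≠ 0 := by
      intro h0
      refine hb (funext fun r => hχ _ (Units.ext ?_))
      have := DFunLike.congr_fun h0 (Pi.single r 1)
      simpa [ψ] using this
    have h1 := AddChar.sum_eq_zero_iff_ne_zero.2 hψ
    have h2 : ∀ p, ψ p = (χ (b ⬝ᵥ p) : ℂˣ) := fun p => rfl
    simp only [h2] at h1
    simp [ha, ← Finset.mul_sum, h1]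
  · simp [ha]

theorem compBasis_orthonormal : Orthonormal ℂ (compBasis d n) := by
  rw [orthonormal_iff_ite]
  intro p q
  simp [inner_def, Finsupp.single_apply]

theorem inner_weylOp (hc : ‖(c : ℂ)‖ = 1) (hχ : ∀ x, ‖(χ x : ℂ)‖ = 1) (u v : QuditSpace d n) :
    inner ℂ (weylOp χ c a b u) (weylOp χ c a b v) = inner ℂ u v := by
  have hrepr (u : QuditSpace d n) (p) :
      (compBasis d n).repr (weylOp χ c a b u) (p + a) =
        ((c * χ (b ⬝ᵥ p) : ℂˣ) : ℂ) * (compBasis d n).repr u p := by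
    have h : (compBasis d n).coord (p + a) ∘ₗ (weylOp χ c a b).toLinearMap =
        ((c * χ (b ⬝ᵥ p) : ℂˣ) : ℂ) • (compBasis d n).coord p := by
      refine (compBasis d n).ext fun q => ?_
      by_cases h : q = p
      · subst h; simp [weylOp_compBasis]
      · simp [weylOp_compBasis, h]
    exact LinearMap.congr_fun h u
  rw [inner_def, inner_def, ← Equiv.sum_comp (Equiv.addRight a)]
  refine Finset.sum_congr rfl fun p _ => ?_
  rw [Equiv.coe_addRight, hrepr, hrepr]
  have h1 : conj ((c * χ (b ⬝ᵥ p) : ℂˣ) : ℂ) * ((c * χ (b ⬝ᵥ p) : ℂˣ) : ℂ) = 1 := by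
    rw [Complex.conj_mul', Units.val_mul, norm_mul, hc, hχ]
    simp
  rw [map_mul]
  linear_combination
    (conj ((compBasis d n).repr u p) * (compBasis d n).repr v p) * h1

end Weyl

/-! ### Symbols of Pauli operators and their commutation -/

/-- Symbols of Pauli operators: exponents of the shifts and of the clocks. -/
abbrev Phase (d n : ℕ) : Type := (Fin n → ZMod d) × (Fin n → ZMod d)

/-- The symplectic form on symbols. -/
def symp (d n : ℕ) : LinearMap.BilinForm (ZMod d) (Phase d n) :=
  LinearMap.mk₂ (ZMod d) (fun x y => x.2 ⬝ᵥ y.1 - y.2 ⬝ᵥ x.1)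
    (fun x y z => by simp [add_dotProduct, dotProduct_add]; ring)
    (fun r x y => by simp [smul_dotProduct, dotProduct_smul]; ring)
    (fun x y z => by simp [add_dotProduct, dotProduct_add]; ring)
    (fun r x y => by simp [smul_dotProduct, dotProduct_smul]; ring)

section Pauli

variable {d n : ℕ} [NeZero d] {ζ : ℂˣ}

open QuditSpace

theorem isPrimitiveRoot_sq (hζ : IsPrimitiveRoot (ζ : ℂ) (dbar d)) : IsPrimitiveRoot (ζ ^ 2) d := by
  have h1 : IsPrimitiveRoot ζ (dbar d) := IsPrimitiveRoot.coe_units_iff.1 hζ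
  unfold dbar at h1
  split_ifs at h1 with hd
  · exact h1.pow_of_coprime 2 (Nat.coprime_two_left.2 hd)
  · exact h1.pow (by have := NeZero.pos d; omega) rfl

/-- The character `x ↦ ξ ^ x` of `ℤ/d`, where `ξ = ζ ^ 2`. -/
def zetaChar (hζ : IsPrimitiveRoot (ζ : ℂ) (dbar d)) : AddChar (ZMod d) ℂˣ :=
  AddChar.zmodChar d (isPrimitiveRoot_sq hζ).pow_eq_one

variable (hζ : IsPrimitiveRoot (ζ : ℂ) (dbar d))

theorem zetaChar_apply (x : ZMod d) : zetaChar hζ x = (ζ ^ 2) ^ x.val := rfl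

theorem zetaChar_natCast (x : ℕ) : zetaChar hζ x = (ζ ^ 2) ^ x :=
  AddChar.zmodChar_apply' _ x

theorem dbar_pos : 0 < dbar d := by
  have := NeZero.pos d
  unfold dbar; split_ifs <;> omega

theorem zetaChar_eq_one (x : ZMod d) (h : zetaChar hζ x = 1) : x = 0 := by
  rw [← ZMod.val_eq_zero]
  exact Nat.eq_zero_of_dvd_of_lt ((isPrimitiveRoot_sq hζ).dvd_of_pow_eq_one _ h) (ZMod.val_lt x)

include hζ in
theorem norm_zeta : ‖(ζ : ℂ)‖ = 1 :=
  Complex.norm_eq_one_of_pow_eq_one hζ.pow_eq_one (dbar_pos (d := d)).ne'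

theorem norm_zetaChar (x : ZMod d) : ‖(zetaChar hζ x : ℂ)‖ = 1 := by
  simp [zetaChar_apply, norm_zeta hζ]

include hζ in
theorem norm_zeta_zpow (c : ℤ) : ‖((ζ ^ c : ℂˣ) : ℂ)‖ = 1 := by
  simp [norm_zeta hζ]

omit [NeZero d] in
theorem onSite_pure (r : Fin n) (T : Qudit d ≃ₗ[ℂ] Qudit d) (x : Fin n → Qudit d) :
    onSite r T (pure d n x) = pure d n (Function.update x r (T (x r))) := by
  have h : onSite r T (pure d n x) =
      pure d n fun s => (if s = r then T else LinearEquiv.refl ℂ (Qudit d)) (x s) :=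
    PiTensorProduct.congr_tprod _ _
  rw [h]
  congr 1
  funext s
  by_cases hs : s = r
  · subst hs; simp
  · simp [hs]

theorem onSite_opX (r : Fin n) :
    onSite r (opX d) = weylOp (zetaChar hζ) 1 (Pi.single r 1) 0 := by
  refine linearEquiv_ext_compBasis fun p => ?_
  rw [weylOp_compBasis, compBasis_apply, onSite_pure, opX_apply, compBasis_apply]
  simp only [zero_dotProduct, AddChar.map_zero_eq_one, mul_one, Units.val_one, one_smul]
  congr 1
  funext s
  by_cases hs : s = r
  · subst hs; simp
  · simp [hs]

theorem onSite_opZ (r : Fin n) :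
    onSite r (opZ d ζ) = weylOp (zetaChar hζ) 1 0 (Pi.single r 1) := by
  refine linearEquiv_ext_compBasis fun p => ?_
  rw [weylOp_compBasis, compBasis_apply, onSite_pure, opZ_apply, MultilinearMap.map_update_smul,
    compBasis_apply, Function.update_eq_self]
  simp [zetaChar_apply]

/-- Products create phases that are powers of `ξ = ζ ^ 2`, whence the factor 2 in the exponents
below. -/
theorem exists_eq_weylOp {g : QuditSpace d n ≃ₗ[ℂ] QuditSpace d n} (hg : g ∈ pauliGroup d n ζ) :
    ∃ (c : ℤ) (x : Phase d n), g = weylOp (zetaChar hζ) (ζ ^ c) x.1 x.2 := by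
  induction hg using Subgroup.closure_induction with
  | mem g hg =>
    rcases hg with (⟨r, rfl⟩ | ⟨r, rfl⟩) | rfl
    · exact ⟨0, (Pi.single r 1, 0), by simp [onSite_opX hζ]⟩
    · exact ⟨0, (0, Pi.single r 1), by simp [onSite_opZ hζ]⟩
    · exact ⟨1, 0, by simp [weylOp_zero]⟩
  | one => exact ⟨0, 0, by simp [weylOp_one]⟩
  | mul g h _ _ hg hh =>
    obtain ⟨c, x, rfl⟩ := hg
    obtain ⟨c', y, rfl⟩ := hh
    refine ⟨c + c' + 2 * (x.2 ⬝ᵥ y.1).val, x + y, ?_⟩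
    rw [weylOp_mul, zetaChar_apply, zpow_add, zpow_add, zpow_mul, zpow_natCast]
    rfl
  | inv g _ hg =>
    obtain ⟨c, x, rfl⟩ := hg
    refine ⟨-c + 2 * (x.2 ⬝ᵥ x.1).val, -x, ?_⟩
    rw [inv_eq_iff_mul_eq_one, weylOp_mul, zpow_add, zpow_neg, zpow_mul, zpow_natCast, ← weylOp_one]
    congr 1
    · simp [AddChar.map_neg_eq_inv, zetaChar_apply]
    · simp
    · simp

theorem weylOp_one_mem (x : Phase d n) :
    weylOp (zetaChar hζ) 1 x.1 x.2 ∈ pauliGroup d n ζ := by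
  have hX (a : Fin n → ZMod d) : weylOp (zetaChar hζ) 1 a 0 ∈ pauliGroup d n ζ := by
    refine Pi.single_induction _ a (by simp [weylOp_one, one_mem]) (fun f g hf hg => ?_)
      fun r m => ?_
    · simpa [weylOp_mul] using mul_mem hf hg
    · rw [← ZMod.natCast_zmod_val m]
      induction m.val with
      | zero => simp [weylOp_one, one_mem]
      | succ t ih =>
        have := mul_mem ih (Subgroup.subset_closure (Or.inl (Or.inl ⟨r, rfl⟩)) :
          onSite r (opX d) ∈ pauliGroup d n ζ)
        rw [onSite_opX hζ, weylOp_mul] at this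
        simpa [Pi.single_add] using this
  have hZ (b : Fin n → ZMod d) : weylOp (zetaChar hζ) 1 0 b ∈ pauliGroup d n ζ := by
    refine Pi.single_induction _ b (by simp [weylOp_one, one_mem]) (fun f g hf hg => ?_)
      fun r m => ?_
    · simpa [weylOp_mul] using mul_mem hf hg
    · rw [← ZMod.natCast_zmod_val m]
      induction m.val with
      | zero => simp [weylOp_one, one_mem]
      | succ t ih =>
        have := mul_mem ih (Subgroup.subset_closure (Or.inl (Or.inr ⟨r, rfl⟩)) :
          onSite r (opZ d ζ) ∈ pauliGroup d n ζ)
        rw [onSite_opZ hζ, weylOp_mul] at this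
        simpa [Pi.single_add] using this
  have := mul_mem (hX x.1) (hZ x.2)
  rw [weylOp_mul] at this
  simpa using this

theorem opScalar_zpow (c : ℤ) :
    (opScalar d n ζ ^ c : QuditSpace d n ≃ₗ[ℂ] QuditSpace d n) = opScalar d n (ζ ^ c) := by
  let φ : ℂˣ →* (QuditSpace d n ≃ₗ[ℂ] QuditSpace d n) :=
    MonoidHom.mk' (opScalar d n) fun c c' => by
      rw [← weylOp_zero (χ := 1), ← weylOp_zero (χ := 1), ← weylOp_zero (χ := 1), weylOp_mul]
      simp
  exact (map_zpow φ ζ c).symm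

theorem weylOp_mem (c : ℤ) (x : Phase d n) :
    weylOp (zetaChar hζ) (ζ ^ c) x.1 x.2 ∈ pauliGroup d n ζ := by
  have h0 : opScalar d n ζ ∈ pauliGroup d n ζ := Subgroup.subset_closure (Or.inr rfl)
  have h1 := zpow_mem h0 c
  have := mul_mem h1 (weylOp_one_mem hζ x)
  rw [opScalar_zpow, ← weylOp_zero (χ := zetaChar hζ), weylOp_mul] at this
  simpa using this

/-- The reorderings contribute `ξ` to the power `(b ⬝ a) t (t - 1) / 2`; written with `ζ`, the
halving disappears. -/
theorem weylOp_pow (c : ℤ) (x : Phase d n) (t : ℕ) :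
    weylOp (zetaChar hζ) (ζ ^ c) x.1 x.2 ^ t =
      weylOp (zetaChar hζ) (ζ ^ (c * t + (x.2 ⬝ᵥ x.1).val * (t * (t - 1)) : ℤ))
        ((t : ZMod d) • x.1) ((t : ZMod d) • x.2) := by
  induction t with
  | zero => simp [weylOp_one]
  | succ t ih =>
    rw [pow_succ, ih, weylOp_mul]
    congr 1
    · rw [smul_dotProduct, smul_eq_mul, ← ZMod.natCast_zmod_val (x.2 ⬝ᵥ x.1), ← Nat.cast_mul,
        zetaChar_natCast, ZMod.natCast_zmod_val, ← zpow_natCast, ← zpow_natCast ζ 2, ← zpow_mul,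
        ← zpow_add, ← zpow_add]
      congr 1
      push_cast
      ring
    · push_cast; rw [add_smul, one_smul]
    · push_cast; rw [add_smul, one_smul]

/-- The symbol of a Pauli operator. -/
def symb (g : pauliGroup d n ζ) : Phase d n := (exists_eq_weylOp hζ g.2).choose_spec.choose

theorem eq_weylOp_symb (g : pauliGroup d n ζ) :
    ∃ c : ℤ, g.1 = weylOp (zetaChar hζ) (ζ ^ c) (symb hζ g).1 (symb hζ g).2 :=
  ⟨_, (exists_eq_weylOp hζ g.2).choose_spec.choose_spec⟩

theorem symb_eq {g : pauliGroup d n ζ} {c : ℂˣ} {x : Phase d n}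
    (h : g.1 = weylOp (zetaChar hζ) c x.1 x.2) : symb hζ g = x := by
  obtain ⟨c', hc⟩ := eq_weylOp_symb hζ g
  obtain ⟨_, h1, h2⟩ := weylOp_injective (zetaChar_eq_one hζ) (hc.symm.trans h)
  exact Prod.ext h1 h2

theorem symb_mul (g h : pauliGroup d n ζ) : symb hζ (g * h) = symb hζ g + symb hζ h := by
  obtain ⟨c, hc⟩ := eq_weylOp_symb hζ g
  obtain ⟨c', hc'⟩ := eq_weylOp_symb hζ h
  refine symb_eq hζ (c := ?_) ?_
  rotate_left
  · rw [Subgroup.coe_mul, hc, hc', weylOp_mul]; rfl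

/-- The symbol map, as a homomorphism of groups. -/
def symbHom : Additive (pauliGroup d n ζ) →+ Phase d n :=
  AddMonoidHom.mk' (fun g => symb hζ g.toMul) fun g h => symb_mul hζ g.toMul h.toMul

theorem symb_one : symb hζ (1 : pauliGroup d n ζ) = 0 := map_zero (symbHom hζ)

theorem symb_inv (g : pauliGroup d n ζ) : symb hζ g⁻¹ = -symb hζ g :=
  map_neg (symbHom hζ) (Additive.ofMul g)

theorem coe_pauliScalar_zpow (c : ℤ) :
    (pauliScalar d n ζ ^ c : pauliGroup d n ζ).1 = opScalar d n (ζ ^ c) := by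
  rw [← opScalar_zpow]
  simp [pauliScalar]

/-- This translates the absence of scalars in a subgroup into injectivity of the symbol on it. -/
theorem symb_eq_zero_iff (g : pauliGroup d n ζ) :
    symb hζ g = 0 ↔ g ∈ Subgroup.zpowers (pauliScalar d n ζ) := by
  constructor
  · intro h
    obtain ⟨c, hc⟩ := eq_weylOp_symb hζ g
    refine Subgroup.mem_zpowers_iff.2 ⟨c, Subtype.ext ?_⟩
    rw [coe_pauliScalar_zpow, hc, h]
    exact weylOp_zero.symm
  · intro h
    obtain ⟨c, rfl⟩ := Subgroup.mem_zpowers_iff.1 h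
    refine symb_eq hζ (c := ζ ^ c) ?_
    rw [coe_pauliScalar_zpow]
    exact weylOp_zero.symm

theorem apply_apply_eq_smul (g h : pauliGroup d n ζ) (v : QuditSpace d n) :
    g.1 (h.1 v) = (zetaChar hζ (symp d n (symb hζ g) (symb hζ h)) : ℂ) • h.1 (g.1 v) := by
  obtain ⟨c, hc⟩ := eq_weylOp_symb hζ g
  obtain ⟨c', hc'⟩ := eq_weylOp_symb hζ h
  generalize symb hζ g = x at *
  generalize symb hζ h = y at *
  have h1 : g.1 * h.1 = opScalar d n (zetaChar hζ (symp d n x y)) * (h.1 * g.1) := by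
    rw [hc, hc', weylOp_mul, weylOp_mul, ← weylOp_zero (χ := zetaChar hζ), weylOp_mul]
    congr 1
    · simp only [symp, LinearMap.mk₂_apply, AddChar.map_sub_eq_div, zero_dotProduct,
        AddChar.map_zero_eq_one, mul_one]
      rw [mul_comm (ζ ^ c'), div_mul_eq_mul_div, eq_div_iff_mul_eq']
      refine Units.ext ?_
      simp only [Units.val_mul]
      ring
    · simp [add_comm]
    · simp [add_comm]
  exact LinearEquiv.congr_fun h1 v

theorem mul_comm_iff (g h : pauliGroup d n ζ) :
    g * h = h * g ↔ symp d n (symb hζ g) (symb hζ h) = 0 := by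
  constructor
  · intro hgh
    have h1 := apply_apply_eq_smul hζ g h (compBasis d n 0)
    have h2 : g.1 (h.1 (compBasis d n 0)) = h.1 (g.1 (compBasis d n 0)) :=
      congrArg (fun x : pauliGroup d n ζ => x.1 (compBasis d n 0)) hgh
    have h3 : h.1 (g.1 (compBasis d n 0)) ≠ 0 := by
      simp only [ne_eq, LinearEquiv.map_eq_zero_iff]
      exact (compBasis d n).ne_zero 0
    rw [h2, eq_comm] at h1
    have h4 := smul_left_injective ℂ h3 (h1.trans (one_smul ℂ _).symm)
    exact zetaChar_eq_one hζ _ (Units.ext h4)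
  · intro h0
    refine Subtype.ext (LinearEquiv.ext fun v => ?_)
    have := apply_apply_eq_smul hζ g h v
    rw [h0] at this
    simpa using this

include hζ in
theorem inner_pauli (g : pauliGroup d n ζ) (u v : QuditSpace d n) :
    inner ℂ (g.1 u) (g.1 v) = inner ℂ u v := by
  obtain ⟨c, hc⟩ := eq_weylOp_symb hζ g
  rw [hc]
  exact inner_weylOp (norm_zeta_zpow hζ c) (norm_zetaChar hζ) u v

theorem trace_pauli (g : pauliGroup d n ζ) (h : symb hζ g ≠ 0) :
    LinearMap.trace ℂ _ g.1.toLinearMap = 0 := by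
  obtain ⟨c, hc⟩ := eq_weylOp_symb hζ g
  rw [hc]
  exact trace_weylOp (zetaChar_eq_one hζ) h

/-- Every symbol is the symbol of a Pauli operator of order dividing `d`. -/
theorem exists_symb_eq_pow_eq_one (x : Phase d n) :
    ∃ g : pauliGroup d n ζ, symb hζ g = x ∧ g ^ d = 1 := by
  -- The phase exponent `c` solves `c d + (b ⬝ a) d (d - 1) = 0`. For even `d` it may be odd, so
  -- that powers of `ξ` would not suffice.
  refine ⟨⟨_, weylOp_mem hζ (-((x.2 ⬝ᵥ x.1).val * (d - 1))) x⟩, symb_eq hζ rfl, ?_⟩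
  refine Subtype.ext ?_
  rw [Subgroup.coe_pow, weylOp_pow, Subgroup.coe_one, ← weylOp_one (χ := zetaChar hζ)]
  congr 1
  · rw [← zpow_zero ζ]; congr 1; ring
  · simp
  · simp

include hζ in
theorem pow_dbar_eq_one (g : pauliGroup d n ζ) : g ^ dbar d = 1 := by
  obtain ⟨c, hc⟩ := eq_weylOp_symb hζ g
  have hd : d ∣ dbar d := by
    unfold dbar; split_ifs
    exacts [dvd_rfl, dvd_mul_left _ _]
  refine Subtype.ext ?_
  have h0 : (dbar d : ZMod d) = 0 := (ZMod.natCast_eq_zero_iff _ _).2 hd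
  rw [Subgroup.coe_pow, hc, weylOp_pow, h0, Subgroup.coe_one, ← weylOp_one (χ := zetaChar hζ)]
  congr 1
  · have h1 : ζ ^ dbar d = 1 := Units.ext (by simpa using hζ.pow_eq_one)
    rw [show c * (dbar d : ℤ) + ((symb hζ g).2 ⬝ᵥ (symb hζ g).1).val *
        ((dbar d : ℤ) * ((dbar d : ℤ) - 1)) = (dbar d : ℤ) *
          (c + ((symb hζ g).2 ⬝ᵥ (symb hζ g).1).val * ((dbar d : ℤ) - 1)) by ring, zpow_mul,
      zpow_natCast, h1, one_zpow]
  · simp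
  · simp

end Pauli

/-! ### Symplectic linear algebra over `ℤ/d` -/

section Symplectic

theorem symp_self {d n : ℕ} (x : Phase d n) : symp d n x x = 0 := by simp [symp]

theorem symp_antisymm {d n : ℕ} (x y : Phase d n) : symp d n x y = -symp d n y x := by simp [symp]

theorem symp_comm_eq_zero {d n : ℕ} {x y : Phase d n} (h : symp d n x y = 0) :
    symp d n y x = 0 := by
  rw [symp_antisymm, h, neg_zero]

theorem eq_zero_of_symp {d n : ℕ} {x : Phase d n} (h : ∀ y, symp d n x y = 0) : x = 0 := by
  refine Prod.ext (funext fun r => ?_) (funext fun r => ?_)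
  · simpa [symp] using h (0, Pi.single r 1)
  · simpa [symp] using h (Pi.single r 1, 0)

variable {d n : ℕ} [NeZero d] {ι : Type*} [Fintype ι]

/-- A proper subgroup of `(ℤ/d)^ι` is killed by a nonzero linear form. -/
theorem exists_dotProduct_eq_zero {S : AddSubgroup (ι → ZMod d)} (hS : S ≠ ⊤) :
    ∃ c : ι → ZMod d, c ≠ 0 ∧ ∀ y ∈ S, c ⬝ᵥ y = 0 := by
  classical
  obtain ⟨a, -, ha⟩ := SetLike.exists_of_lt (lt_top_iff_ne_top.2 hS)
  have ha' : (QuotientAddGroup.mk a : (ι → ZMod d) ⧸ S) ≠ 0 := by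
    rwa [ne_eq, QuotientAddGroup.eq_zero_iff]
  -- Characters separate the points of the quotient. The values of `ψ` at the unit vectors are
  -- `d`-th roots of unity, and their exponents are the coefficients of the form.
  obtain ⟨ψ, hψ⟩ := AddChar.exists_apply_ne_zero.2 ha'
  have hω := Complex.isPrimitiveRoot_exp d (NeZero.ne d)
  set ω := Complex.exp (2 * Real.pi * Complex.I / d)
  have hc (i : ι) : ∃ t < d, ω ^ t = ψ (QuotientAddGroup.mk (Pi.single i 1)) := by
    refine hω.eq_pow_of_pow_eq_one ?_
    rw [← AddChar.map_nsmul_eq_pow, ← QuotientAddGroup.mk_nsmul, ← Pi.single_smul]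
    simp
  choose t htd ht using hc
  let χ := AddChar.zmodChar d hω.pow_eq_one
  have hχ (y : ι → ZMod d) : χ ((fun i => (t i : ZMod d)) ⬝ᵥ y) = ψ (QuotientAddGroup.mk y) := by
    refine Pi.single_induction _ y (by simp) (fun f g hf hg => ?_) fun i m => ?_
    · rw [dotProduct_add, AddChar.map_add_eq_mul, hf, hg, QuotientAddGroup.mk_add,
        AddChar.map_add_eq_mul]
    · have h1 : Pi.single i m = m.val • (Pi.single i 1 : ι → ZMod d) := by
        rw [← Pi.single_smul]; simp
      rw [h1, QuotientAddGroup.mk_nsmul, AddChar.map_nsmul_eq_pow, ← ht, dotProduct_smul,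
        AddChar.map_nsmul_eq_pow, dotProduct_single, mul_one, AddChar.zmodChar_apply']
  refine ⟨fun i => (t i : ZMod d), fun h0 => hψ ?_, fun y hy => ?_⟩
  · rw [← hχ, h0]; simp
  · have h1 := hχ y
    rw [(QuotientAddGroup.eq_zero_iff y).2 hy, AddChar.map_zero_eq_one,
      AddChar.zmodChar_apply] at h1
    rw [← ZMod.val_eq_zero]
    exact Nat.eq_zero_of_dvd_of_lt (hω.dvd_of_pow_eq_one _ h1) (ZMod.val_lt _)

/-- A linearly independent family of symbols has a dual family for the symplectic form. -/
theorem exists_symp_dual [DecidableEq ι] {e : ι → Phase d n}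
    (he : LinearIndependent (ZMod d) e) :
    ∃ f : ι → Phase d n, ∀ i j, symp d n (e i) (f j) = if i = j then 1 else 0 := by
  let T : Phase d n →ₗ[ZMod d] ι → ZMod d := LinearMap.pi fun i => symp d n (e i)
  -- A form `c` killing the range would put `∑ c i • e i` in the radical of the symplectic form,
  -- which is zero.
  have hT : T.range.toAddSubgroup = ⊤ := by
    by_contra hne
    obtain ⟨c, hc0, hc⟩ := exists_dotProduct_eq_zero hne
    refine hc0 (funext (Fintype.linearIndependent_iff.1 he c (eq_zero_of_symp fun x => ?_)))
    have h1 := hc (T x) ⟨x, rfl⟩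
    simpa [dotProduct, T] using h1
  have hs (j : ι) : ∃ x, T x = Pi.single j 1 := by
    have : Pi.single j 1 ∈ T.range.toAddSubgroup := hT ▸ AddSubgroup.mem_top _
    exact this
  choose f hf using hs
  refine ⟨f, fun i j => ?_⟩
  have := congrFun (hf j) i
  simpa [T, Pi.single_apply] using this

/-- An isotropic linearly independent family with fewer than `n` members can be extended. -/
theorem exists_isotropic_extension {e : ι → Phase d n} (he : LinearIndependent (ZMod d) e)
    (hcard : Fintype.card ι < n) :
    ∃ z : Phase d n, (∀ i, symp d n (e i) z = 0) ∧
      ∀ c : ZMod d, c • z ∈ Submodule.span (ZMod d) (Set.range e) → c = 0 := by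
  classical
  set L := Submodule.span (ZMod d) (Set.range e) with hL
  let T : Phase d n →ₗ[ZMod d] ι → ZMod d := LinearMap.pi fun i => symp d n (e i)
  -- With `L^⊥ = T.ker`, the group `Q = L^⊥ / (L ∩ L^⊥)` is finite abelian, so some element has
  -- order equal to the exponent. If that order is `d`, any lift of the element is the required `z`.
  let Q := T.ker ⧸ L.comap T.ker.subtype
  have hdQ (q : Q) : d • q = 0 := by
    rw [← Nat.cast_smul_eq_nsmul (ZMod d)]; simp
  have : Finite Q := Quotient.finite _
  obtain ⟨q, hq⟩ := AddMonoid.exists_addOrderOf_eq_exponent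
    (AddMonoid.ExponentExists.of_finite (G := Q))
  have hsd : AddMonoid.exponent Q ∣ d := AddMonoid.exponent_dvd_of_forall_nsmul_eq_zero hdQ
  set s := AddMonoid.exponent Q with hs
  by_cases hsd' : s = d
  · obtain ⟨z, rfl⟩ := Submodule.Quotient.mk_surjective _ q
    refine ⟨z, fun i => congrFun z.2 i, fun c hc => ?_⟩
    have h1 : c.val • (Submodule.Quotient.mk z : Q) = 0 := by
      rw [← Nat.cast_smul_eq_nsmul (ZMod d), ZMod.natCast_zmod_val, ← Submodule.Quotient.mk_smul,
        Submodule.Quotient.mk_eq_zero]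
      exact hc
    rw [← ZMod.val_eq_zero]
    refine Nat.eq_zero_of_dvd_of_lt ?_ (ZMod.val_lt c)
    rw [← addOrderOf_dvd_iff_nsmul_eq_zero, hq, hsd'] at h1
    exact h1
  -- If the exponent is a proper divisor `s` of `d`, then `s L^⊥ ⊆ L`. With `I = s(ℤ/d) ≠ 0`, every
  -- vector over `I` turns out to be a combination of the `e i` and their duals with coefficients in
  -- `I`. Hence `|I|^{2n} ≤ |I|^{2|ι|}`, against `|ι| < n`.
  · exfalso
    obtain ⟨f, hf⟩ := exists_symp_dual he
    obtain ⟨t, ht⟩ := hsd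
    have hs0 : (s : ZMod d) ≠ 0 := by
      rw [ne_eq, ZMod.natCast_eq_zero_iff]
      intro h
      exact hsd' (Nat.dvd_antisymm ⟨t, ht⟩ h)
    let I : Ideal (ZMod d) := Ideal.span {(s : ZMod d)}
    have hI : 1 < Fintype.card I := by
      rw [Fintype.one_lt_card_iff]
      exact ⟨0, ⟨s, Ideal.mem_span_singleton_self _⟩, fun h => hs0 (congrArg Subtype.val h).symm⟩
    have hIt (c : ZMod d) (hc : (t : ZMod d) * c = 0) : c ∈ I := by
      rw [Ideal.mem_span_singleton]
      rw [← ZMod.natCast_zmod_val c, ← Nat.cast_mul, ZMod.natCast_eq_zero_iff] at hc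
      have ht0 : 0 < t := Nat.pos_of_ne_zero fun h0 => NeZero.ne d (by rw [ht, h0, mul_zero])
      have : s ∣ c.val := by
        refine Nat.dvd_of_mul_dvd_mul_left ht0 ?_
        rwa [mul_comm t s, ← ht]
      rw [← ZMod.natCast_zmod_val c]
      exact Nat.cast_dvd_cast this
    let F : (ι → I) × (ι → I) → (Fin n → I) × (Fin n → I) := fun u =>
      (fun r => ⟨∑ i, (u.1 i * (e i).1 r + u.2 i * (f i).1 r),
        sum_mem fun i _ => add_mem (I.mul_mem_right _ (u.1 i).2) (I.mul_mem_right _ (u.2 i).2)⟩,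
       fun r => ⟨∑ i, (u.1 i * (e i).2 r + u.2 i * (f i).2 r),
        sum_mem fun i _ => add_mem (I.mul_mem_right _ (u.1 i).2) (I.mul_mem_right _ (u.2 i).2)⟩)
    have hF : Function.Surjective F := by
      intro y
      have h1 (u : I) : ∃ x, s * x = u.1 := by
        obtain ⟨x, hx⟩ := Ideal.mem_span_singleton.1 u.2
        exact ⟨x, hx.symm⟩
      choose g hg using h1
      let x : Phase d n := (fun r => g (y.1 r), fun r => g (y.2 r))
      -- Subtracting the dual components projects `x` into `L^⊥`.
      let x' : Phase d n := x - ∑ i, symp d n (e i) x • f i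
      have hx' : x' ∈ T.ker := by
        refine LinearMap.mem_ker.2 (funext fun i => ?_)
        simp [T, x', hf]
      have h2 : (s : ZMod d) • x' ∈ L := by
        have h3 := AddMonoid.exponent_nsmul_eq_zero (Submodule.Quotient.mk ⟨x', hx'⟩ : Q)
        rw [← hs, ← Nat.cast_smul_eq_nsmul (ZMod d), ← Submodule.Quotient.mk_smul,
          Submodule.Quotient.mk_eq_zero] at h3
        exact h3
      obtain ⟨c, hc⟩ := (Submodule.mem_span_range_iff_exists_fun _).1 h2
      -- Multiplying `s • x'` by `t = d / s` gives 0, so by independence `t` kills each coefficient.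
      have hcI (i) : c i ∈ I := by
        refine hIt _ (Fintype.linearIndependent_iff.1 he (fun i => t * c i) ?_ i)
        simp only [mul_smul]
        rw [← Finset.smul_sum, hc, smul_smul, ← Nat.cast_mul, mul_comm t s, ← ht]
        simp
      have hx : (s : ZMod d) • x = ∑ i, (c i • e i + (s * symp d n (e i) x) • f i) := by
        rw [Finset.sum_add_distrib, hc]
        simp only [mul_smul, x', ← Finset.smul_sum, smul_sub, sub_add_cancel]
      refine ⟨(fun i => ⟨c i, hcI i⟩, fun i => ⟨s * symp d n (e i) x,
        I.mul_mem_right _ (Ideal.mem_span_singleton_self _)⟩), ?_⟩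
      refine Prod.ext (funext fun r => Subtype.ext ?_) (funext fun r => Subtype.ext ?_)
      · have := congrFun (congrArg Prod.fst hx) r
        simp only [F]
        rw [← hg (y.1 r)]
        simpa [x, Prod.fst_sum] using this.symm
      · have := congrFun (congrArg Prod.snd hx) r
        simp only [F]
        rw [← hg (y.2 r)]
        simpa [x, Prod.snd_sum] using this.symm
    have h4 := Fintype.card_le_of_surjective F hF
    simp only [Fintype.card_prod, Fintype.card_fun, Fintype.card_fin, ← pow_add] at h4
    have := (Nat.pow_le_pow_iff_right hI).1 h4
    omega

/-- An isotropic linearly independent family extends to a Lagrangian one. -/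
theorem exists_lagrangian_extension {e : ι → Phase d n} (he : LinearIndependent (ZMod d) e)
    (m : ℕ) (hm : Fintype.card ι + m ≤ n) :
    ∃ e' : Fin m → Phase d n, LinearIndependent (ZMod d) (Sum.elim e' e) ∧
      (∀ i j, symp d n (e i) (e' j) = 0) ∧ ∀ i j, symp d n (e' i) (e' j) = 0 := by
  induction m with
  | zero =>
    refine ⟨Fin.elim0, ?_, fun _ j => j.elim0, fun j => j.elim0⟩
    rw [Fintype.linearIndependent_iff] at he ⊢
    rintro c hc (j | i)
    · exact j.elim0
    · exact he (fun i => c (Sum.inr i)) (by simpa using hc) i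
  | succ m ih =>
    obtain ⟨e', hli, h1, h2⟩ := ih (by omega)
    obtain ⟨z, hz, hzc⟩ := exists_isotropic_extension hli (by simp; omega)
    refine ⟨Fin.cons z e', ?_, fun i j => ?_, fun i j => ?_⟩
    · rw [Fintype.linearIndependent_iff] at hli ⊢
      intro c hc
      simp only [Fintype.sum_sum_type, Sum.elim_inl, Sum.elim_inr, Fin.sum_univ_succ,
        Fin.cons_zero, Fin.cons_succ] at hc
      have hc0 : c (Sum.inl 0) = 0 := by
        refine hzc _ ?_
        rw [add_assoc, add_eq_zero_iff_eq_neg] at hc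
        rw [hc]
        refine neg_mem (add_mem (sum_mem fun i _ => ?_) (sum_mem fun i _ => ?_))
        · exact Submodule.smul_mem _ _ (Submodule.subset_span ⟨Sum.inl i, rfl⟩)
        · exact Submodule.smul_mem _ _ (Submodule.subset_span ⟨Sum.inr i, rfl⟩)
      have h3 := hli (Sum.elim (fun j => c (Sum.inl j.succ)) fun i => c (Sum.inr i))
        (by simpa [hc0] using hc)
      rintro (j | i)
      · induction j using Fin.cases with
        | zero => exact hc0
        | succ j => exact h3 (Sum.inl j)
      · exact h3 (Sum.inr i)
    · induction j using Fin.cases with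
      | zero => exact hz (Sum.inr i)
      | succ j => exact h1 i j
    · induction i using Fin.cases with
      | zero =>
        induction j using Fin.cases with
        | zero => exact symp_self z
        | succ j => exact symp_comm_eq_zero (hz (Sum.inl j))
      | succ i =>
        induction j using Fin.cases with
        | zero => exact hz (Sum.inl i)
        | succ j => exact h2 i j

/-- An isotropic linearly independent family extends to (a part of) a symplectic basis. -/
theorem exists_symplectic_extension {e : ι → Phase d n} (he : LinearIndependent (ZMod d) e)
    (m : ℕ) (hm : Fintype.card ι + m ≤ n) :
    ∃ e' f' : Fin m → Phase d n, LinearIndependent (ZMod d) (Sum.elim e' e) ∧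
      (∀ i j, symp d n (e i) (e' j) = 0) ∧ (∀ i j, symp d n (e' i) (e' j) = 0) ∧
      (∀ i j, symp d n (e i) (f' j) = 0) ∧ (∀ i j, symp d n (f' i) (f' j) = 0) ∧
      ∀ i j, symp d n (e' i) (f' j) = if i = j then 1 else 0 := by
  classical
  obtain ⟨e', hli, h1, h2⟩ := exists_lagrangian_extension he m hm
  obtain ⟨f, hf⟩ := exists_symp_dual hli
  let g : Fin m → Phase d n := fun j => f (Sum.inl j)
  have heg (i j) : symp d n (e i) (g j) = 0 := by simpa using hf (Sum.inr i) (Sum.inl j)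
  have heg' (i j) : symp d n (e' i) (g j) = if i = j then 1 else 0 := by
    simpa using hf (Sum.inl i) (Sum.inl j)
  -- Strictly upper triangular half of the matrix of the form on `g`. It corrects the duals to an
  -- isotropic family without dividing by 2, which is impossible for even `d`.
  let t : Fin m → Fin m → ZMod d := fun i j => if i < j then symp d n (g i) (g j) else 0
  refine ⟨e', fun j => g j + ∑ l, t l j • e' l, hli, h1, h2, fun i j => ?_, fun i j => ?_,
    fun i j => ?_⟩
  · simp [heg, h1]
  · have h3 (i l) : symp d n (g i) (e' l) = if l = i then -1 else 0 := by
      rw [symp_antisymm, heg']; split_ifs <;> simp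
    have h4 : symp d n (g i) (g j) - t i j + t j i = 0 := by
      simp only [t]
      rcases lt_trichotomy i j with h | rfl | h
      · simp [h, not_lt.2 h.le]
      · simp [symp_self]
      · rw [symp_antisymm (g i)]
        simp [h, not_lt.2 h.le]
    simpa [h2, h3, heg', sub_eq_add_neg, add_assoc, add_comm, add_left_comm] using h4
  · simp [heg', h2]

end Symplectic

/-! ### Dimension of the protected space -/

section Dimension

variable {d n : ℕ} [NeZero d] {ζ : ℂˣ} (hζ : IsPrimitiveRoot (ζ : ℂ) (dbar d))

open QuditSpace

instance : FiniteDimensional ℂ (QuditSpace d n) := (compBasis d n).finiteDimensional_of_finite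

theorem finrank_quditSpace : finrank ℂ (QuditSpace d n) = d ^ n := by
  rw [finrank_eq_card_basis (compBasis d n)]
  simp [ZMod.card]

theorem eq_one_of_symb_eq_zero {G : Subgroup (pauliGroup d n ζ)}
    (hG : G ⊓ Subgroup.zpowers (pauliScalar d n ζ) = ⊥) {g : pauliGroup d n ζ} (hg : g ∈ G)
    (h : symb hζ g = 0) : g = 1 := by
  have h1 : g ∈ G ⊓ Subgroup.zpowers (pauliScalar d n ζ) := ⟨hg, (symb_eq_zero_iff hζ g).1 h⟩
  rwa [hG, Subgroup.mem_bot] at h1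

theorem symb_injOn {G : Subgroup (pauliGroup d n ζ)}
    (hG : G ⊓ Subgroup.zpowers (pauliScalar d n ζ) = ⊥) {g h : pauliGroup d n ζ} (hg : g ∈ G)
    (hh : h ∈ G) (hgh : symb hζ g = symb hζ h) : g = h := by
  rw [← mul_inv_eq_one]
  refine eq_one_of_symb_eq_zero hζ hG (mul_mem hg (inv_mem hh)) ?_
  rw [symb_mul, symb_inv, hgh, add_neg_cancel]

include hζ in
theorem finite_of_inf_eq_bot {G : Subgroup (pauliGroup d n ζ)}
    (hG : G ⊓ Subgroup.zpowers (pauliScalar d n ζ) = ⊥) : Finite G :=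
  Finite.of_injective (fun g : G => symb hζ g.1) fun g h hgh =>
    Subtype.ext (symb_injOn hζ hG g.2 h.2 hgh)

-- The dimension is the trace of the averaging projection, to which only the identity contributes.
include hζ in
theorem finrank_fixedSpace_mul_card {G : Subgroup (pauliGroup d n ζ)}
    (hG : G ⊓ Subgroup.zpowers (pauliScalar d n ζ) = ⊥) :
    finrank ℂ (fixedSpace G) * Nat.card G = d ^ n := by
  have := finite_of_inf_eq_bot hζ hG
  have := Fintype.ofFinite G
  have hcard : (Fintype.card G : ℂ) ≠ 0 := Nat.cast_ne_zero.2 Fintype.card_ne_zero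
  have := invertibleOfNonzero hcard
  let ρ : Representation ℂ G (QuditSpace d n) :=
    { toFun := fun g => g.1.1.toLinearMap
      map_one' := rfl
      map_mul' := fun _ _ => rfl }
  have hinv : ρ.invariants = fixedSpace G := by
    ext v
    exact ⟨fun h g hg => h ⟨g, hg⟩, fun h g => h g.1 g.2⟩
  have h1 := ρ.isProj_averageMap.trace
  have h2 : LinearMap.trace ℂ _ ρ.averageMap = (Fintype.card G : ℂ)⁻¹ * d ^ n := by
    have h3 : ∑ g : G, LinearMap.trace ℂ _ (ρ g) = d ^ n := by
      rw [Finset.sum_eq_single 1]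
      · rw [map_one, LinearMap.trace_one, finrank_quditSpace]
        push_cast; rfl
      · intro g _ hg
        exact trace_pauli hζ g.1 fun h0 => hg (Subtype.ext (eq_one_of_symb_eq_zero hζ hG g.2 h0))
      · simp
    rw [← h3]
    simp [GroupAlgebra.average, map_sum]
  rw [h2, hinv] at h1
  have h4 : ((finrank ℂ (fixedSpace G) * Nat.card G : ℕ) : ℂ) = (d ^ n : ℕ) := by
    push_cast
    rw [← h1, Nat.card_eq_fintype_card]
    field_simp
  exact_mod_cast h4

end Dimension

/-! ### Normalisers and logical frames -/

/-- Commuting elements of order dividing `d` define a homomorphism from `(ℤ/d)^m`. -/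
theorem exists_hom_of_commute {G : Type*} [Group G] {d m : ℕ} {z : Fin m → G}
    (hcomm : ∀ i j, z i * z j = z j * z i) (hz : ∀ i, z i ^ d = 1) :
    ∃ F : Multiplicative (Fin m → ZMod d) →* G,
      ∀ i, F (Multiplicative.ofAdd (Pi.single i 1)) = z i := by
  let φ (i : Fin m) : ZMod d →+ Additive G :=
    ZMod.lift d ⟨zmultiplesHom (Additive G) (Additive.ofMul (z i)), by
      rw [zmultiplesHom_apply, natCast_zsmul, ← ofMul_pow, hz, ofMul_one]⟩
  have hφ (i : Fin m) (x : ℤ) : φ i x = x • Additive.ofMul (z i) := ZMod.lift_coe _ _ _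
  have hc : Pairwise fun i j => ∀ x y, AddCommute (φ i x) (φ j y) := by
    intro i j _ x y
    obtain ⟨x, rfl⟩ := ZMod.intCast_surjective x
    obtain ⟨y, rfl⟩ := ZMod.intCast_surjective y
    rw [hφ, hφ]
    exact AddCommute.zsmul_left (AddCommute.zsmul_right (congrArg Additive.ofMul (hcomm i j)) y) x
  refine ⟨AddMonoidHom.toMultiplicativeLeft (AddMonoidHom.noncommPiCoprod φ hc), fun i => ?_⟩
  have h1 : AddMonoidHom.noncommPiCoprod φ hc (Pi.single i 1) = φ i 1 :=
    AddMonoidHom.noncommPiCoprod_single φ i 1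
  have h2 := hφ i 1
  rw [Int.cast_one, one_zsmul] at h2
  exact h1.trans h2

section Stabiliser

variable {d n m : ℕ} [NeZero d] {ζ : ℂˣ} (hζ : IsPrimitiveRoot (ζ : ℂ) (dbar d))

open QuditSpace

theorem symb_hom (F : Multiplicative (Fin m → ZMod d) →* pauliGroup d n ζ) (y : Fin m → ZMod d) :
    symb hζ (F (Multiplicative.ofAdd y)) =
      ∑ i, y i • symb hζ (F (Multiplicative.ofAdd (Pi.single i 1))) := by
  let φ : (Fin m → ZMod d) →+ Phase d n :=
    AddMonoidHom.mk' (fun y => symb hζ (F (Multiplicative.ofAdd y))) fun x y => by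
      rw [ofAdd_add, map_mul, symb_mul]
  change φ.toZModLinearMap d y = _
  rw [LinearMap.pi_apply_eq_sum_univ]
  refine Finset.sum_congr rfl fun i _ => ?_
  have h1 : (fun j => if i = j then 1 else 0) = (Pi.single i 1 : Fin m → ZMod d) := by
    funext j
    simp [Pi.single_apply, eq_comm]
  rw [h1]
  rfl

include hζ in
/-- A subgroup without scalars contains every Pauli operator that fixes its protected space. -/
theorem mem_of_forall_apply_eq {H : Subgroup (pauliGroup d n ζ)}
    (hH : H ⊓ Subgroup.zpowers (pauliScalar d n ζ) = ⊥) {g : pauliGroup d n ζ}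
    (hg : ∀ v ∈ fixedSpace H, g.1 v = v) : g ∈ H := by
  -- The pointwise stabiliser of `V^H` contains `H`, has the same fixed space, and contains no
  -- nontrivial scalar since `V^H ≠ 0`. By the dimension formula it has the order of `H`.
  let G : Subgroup (pauliGroup d n ζ) :=
    { carrier := {g | ∀ v ∈ fixedSpace H, g.1 v = v}
      one_mem' := fun v _ => rfl
      mul_mem' := fun {g h} hg hh v hv => by
        change g.1 (h.1 v) = v
        rw [hh v hv, hg v hv]
      inv_mem' := fun {g} hg v hv => by
        change g.1.symm v = v
        rw [LinearEquiv.symm_apply_eq, hg v hv] }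
  have hHG : H ≤ G := fun h hh v hv => hv h hh
  have hfix : fixedSpace G = fixedSpace H :=
    le_antisymm (fun v hv h hh => hv h (hHG hh)) fun v hv g hg => hg v hv
  have hdim := finrank_fixedSpace_mul_card hζ hH
  have hpos : 0 < finrank ℂ (fixedSpace H) := by
    refine Nat.pos_of_ne_zero fun h0 => ?_
    rw [h0, zero_mul] at hdim
    exact (pow_ne_zero n (NeZero.ne d)) hdim.symm
  have hG : G ⊓ Subgroup.zpowers (pauliScalar d n ζ) = ⊥ := by
    rw [eq_bot_iff]
    rintro g ⟨hg, hs⟩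
    obtain ⟨c, rfl⟩ := Subgroup.mem_zpowers_iff.1 hs
    have := finrank_pos_iff.1 hpos
    obtain ⟨v, hv⟩ := exists_ne (0 : fixedSpace H)
    have h1 := hg v.1 v.2
    rw [coe_pauliScalar_zpow] at h1
    have hv0 : v.1 ≠ 0 := fun h => hv (Subtype.ext h)
    have h2 : ((ζ ^ c : ℂˣ) : ℂ) • v.1 = (1 : ℂ) • v.1 := h1.trans (one_smul ℂ _).symm
    have h3 : ζ ^ c = 1 := Units.ext (smul_left_injective ℂ hv0 h2)
    refine Subgroup.mem_bot.2 (Subtype.ext ?_)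
    rw [coe_pauliScalar_zpow, h3, ← weylOp_zero (χ := zetaChar hζ), weylOp_one]
    rfl
  have := finite_of_inf_eq_bot hζ hG
  have hdim' := finrank_fixedSpace_mul_card hζ hG
  rw [hfix, ← hdim] at hdim'
  have hcard := Nat.eq_of_mul_eq_mul_left hpos hdim'
  have : H = G := SetLike.coe_injective
    (Set.eq_of_subset_of_ncard_le hHG hcard.le (Set.toFinite _))
  rw [this]
  exact hg

/-- Conjugation preserves symbols, and the symbol is injective on `H`; so normalising `H` amounts to
centralising it. -/
theorem mem_normalizer_iff_symp {H : Subgroup (pauliGroup d n ζ)}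
    (hH : H ⊓ Subgroup.zpowers (pauliScalar d n ζ) = ⊥) {g : pauliGroup d n ζ} :
    g ∈ Subgroup.normalizer (H : Set (pauliGroup d n ζ)) ↔
      ∀ h ∈ H, symp d n (symb hζ g) (symb hζ h) = 0 := by
  constructor
  · intro hg h hh
    have h1 : g * h * g⁻¹ ∈ H := (Subgroup.mem_normalizer_iff.1 hg h).1 hh
    rw [← mul_comm_iff, ← mul_inv_eq_iff_eq_mul]
    refine symb_injOn hζ hH h1 hh ?_
    rw [symb_mul, symb_mul, symb_inv]
    abel
  · intro hg
    have hc (h) (hh : h ∈ H) : g * h * g⁻¹ = h := by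
      rw [mul_inv_eq_iff_eq_mul, mul_comm_iff hζ]
      exact hg h hh
    refine Subgroup.mem_normalizer_iff.2 fun h => ⟨fun hh => by rwa [hc h hh], fun hh => ?_⟩
    have h1 := hc _ hh
    have h2 : g * h * g⁻¹ = h := by
      have h3 : g * (g * h * g⁻¹) = g * h := (mul_inv_eq_iff_eq_mul.1 h1).trans (by group)
      exact mul_left_cancel h3
    rwa [h2] at hh

/-- Commuting logical clock and shift operators for a stabiliser group `H`. -/
structure LogicalFrame (hζ : IsPrimitiveRoot (ζ : ℂ) (dbar d)) (H : Subgroup (pauliGroup d n ζ))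
    (m : ℕ) where
  /-- The logical clock operators. -/
  clock : Multiplicative (Fin m → ZMod d) →* pauliGroup d n ζ
  /-- The logical shift operators. -/
  shift : Multiplicative (Fin m → ZMod d) →* pauliGroup d n ζ
  clock_commute : ∀ h ∈ H, ∀ y, symp d n (symb hζ h) (symb hζ (clock y)) = 0
  shift_commute : ∀ h ∈ H, ∀ y, symp d n (symb hζ h) (symb hζ (shift y)) = 0
  clock_shift : ∀ x y, symp d n (symb hζ (clock (.ofAdd x))) (symb hζ (shift (.ofAdd y))) = x ⬝ᵥ y
  independent : ∀ y, ∀ h ∈ H, symb hζ (h * clock y) = 0 → y = 1 ∧ h = 1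

/-- A free subgroup without scalars has logical frames. Such a subgroup is commutative, because
commutators of Pauli operators are scalars. -/
theorem exists_logicalFrame {k : ℕ} {H : Subgroup (pauliGroup d n ζ)}
    (hH : H ⊓ Subgroup.zpowers (pauliScalar d n ζ) = ⊥)
    (φ : Additive H ≃+ (Fin k → ZMod d)) (hkm : k + m ≤ n) :
    Nonempty (LogicalFrame hζ H m) := by
  let σ : (Fin k → ZMod d) →ₗ[ZMod d] Phase d n := AddMonoidHom.toZModLinearMap d
    ((symbHom hζ).comp (H.subtype.toAdditive.comp φ.symm.toAddMonoidHom))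
  have hσ (x) : σ x = symb hζ (φ.symm x).toMul.1 := rfl
  have hσH (h) (hh : h ∈ H) : symb hζ h = σ (φ (.ofMul ⟨h, hh⟩)) := by rw [hσ]; simp
  have hσ0 (x) (hx : σ x = 0) : x = 0 := by
    have h1 := eq_one_of_symb_eq_zero hζ hH (φ.symm x).toMul.2 hx
    have h2 : φ.symm x = 0 := Subtype.ext h1
    simpa using h2
  have hσs (x) : σ x = ∑ i, x i • σ (Pi.single i 1) := by
    rw [LinearMap.pi_apply_eq_sum_univ]
    refine Finset.sum_congr rfl fun i _ => ?_
    congr 2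
    funext j
    simp [Pi.single_apply, eq_comm]
  have hli : LinearIndependent (ZMod d) fun i => σ (Pi.single i 1) := by
    rw [Fintype.linearIndependent_iff]
    intro c hc
    rw [← hσs] at hc
    exact congrFun (hσ0 c hc)
  obtain ⟨e, f, hli', h1, h2, h3, h4, h5⟩ :=
    exists_symplectic_extension hli m (by simpa using hkm)
  -- Lifts of order dividing `d` are what allows the clocks and shifts to be homomorphisms from
  -- `(ℤ/d)^m`.
  choose z hz hzd using exists_symb_eq_pow_eq_one (n := n) hζ
  obtain ⟨Z, hZ⟩ := exists_hom_of_commute (d := d) (z := fun i => z (e i))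
    (fun i j => by rw [mul_comm_iff hζ, hz, hz, h2]) fun i => hzd _
  obtain ⟨X, hX⟩ := exists_hom_of_commute (d := d) (z := fun i => z (f i))
    (fun i j => by rw [mul_comm_iff hζ, hz, hz, h4]) fun i => hzd _
  have hZs (y) : symb hζ (Z (.ofAdd y)) = ∑ i, y i • e i := by simp [symb_hom, hZ, hz]
  have hXs (y) : symb hζ (X (.ofAdd y)) = ∑ i, y i • f i := by simp [symb_hom, hX, hz]
  refine ⟨⟨Z, X, fun h hh y => ?_, fun h hh y => ?_, fun x y => ?_, fun y h hh h0 => ?_⟩⟩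
  · rw [← ofAdd_toAdd y, hZs, hσH h hh, hσs]
    simp [h1]
  · rw [← ofAdd_toAdd y, hXs, hσH h hh, hσs]
    simp [h3]
  · rw [hZs, hXs]
    simp [h5, dotProduct, mul_comm]
  · rw [← ofAdd_toAdd y, symb_mul, hZs, hσH h hh, hσs] at h0
    have h6 := Fintype.linearIndependent_iff.1 hli' (Sum.elim y.toAdd (φ (.ofMul ⟨h, hh⟩)))
      (by simpa [add_comm] using h0)
    refine ⟨Multiplicative.toAdd.injective (funext fun i => h6 (Sum.inl i)), ?_⟩
    have h7 : φ (.ofMul ⟨h, hh⟩) = 0 := funext fun i => h6 (Sum.inr i)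
    rw [map_eq_zero_iff φ φ.injective] at h7
    exact congrArg (fun x : Additive H => x.toMul.1) h7

end Stabiliser

/-! ### The logical basis and the action of the normaliser -/

section Logical

variable {d n m : ℕ} [NeZero d] {ζ : ℂˣ} {hζ : IsPrimitiveRoot (ζ : ℂ) (dbar d)}
  {H : Subgroup (pauliGroup d n ζ)}

open QuditSpace

namespace LogicalFrame

variable (F : LogicalFrame hζ H m)

/-- The products of elements of `H` with logical clock operators form a stabiliser group. -/
theorem exists_maximal :
    ∃ G : Subgroup (pauliGroup d n ζ), (∀ g, g ∈ G ↔ ∃ h ∈ H, ∃ y, h * F.clock y = g) ∧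
      G ⊓ Subgroup.zpowers (pauliScalar d n ζ) = ⊥ ∧ Nat.card G = Nat.card H * d ^ m := by
  let Φ : H × Multiplicative (Fin m → ZMod d) →* pauliGroup d n ζ :=
    MonoidHom.noncommCoprod H.subtype F.clock fun h y =>
      (mul_comm_iff hζ _ _).2 (F.clock_commute h.1 h.2 y)
  have hΦ (x) : Φ x = x.1.1 * F.clock x.2 := rfl
  have h0 (x) (hx : symb hζ (Φ x) = 0) : x = 1 := by
    obtain ⟨h1, h2⟩ := F.independent x.2 x.1.1 x.1.2 hx
    exact Prod.ext (Subtype.ext h2) h1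
  refine ⟨Φ.range, fun g => ?_, ?_, ?_⟩
  · constructor
    · rintro ⟨x, rfl⟩
      exact ⟨x.1.1, x.1.2, x.2, rfl⟩
    · rintro ⟨h, hh, y, rfl⟩
      exact ⟨(⟨h, hh⟩, y), rfl⟩
  · rw [eq_bot_iff]
    rintro _ ⟨⟨x, rfl⟩, hs⟩
    rw [h0 x ((symb_eq_zero_iff hζ _).2 hs), map_one]
    exact Subgroup.mem_bot.2 rfl
  · have hinj : Function.Injective Φ := (injective_iff_map_eq_one Φ).2 fun x hx =>
      h0 x (by rw [hx, symb_one])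
    have h1 := Nat.card_congr (MonoidHom.ofInjective hinj).toEquiv
    rw [← h1, Nat.card_prod]
    congr 1
    rw [Nat.card_congr Multiplicative.toAdd, Nat.card_eq_fintype_card]
    simp [ZMod.card]

theorem clock_apply_shift_apply (b p : Fin m → ZMod d) (v : QuditSpace d n) :
    (F.clock (.ofAdd b)).1 ((F.shift (.ofAdd p)).1 v) =
      (zetaChar hζ (b ⬝ᵥ p) : ℂ) • (F.shift (.ofAdd p)).1 ((F.clock (.ofAdd b)).1 v) := by
  rw [apply_apply_eq_smul hζ, F.clock_shift]

/-- The vectors of the protected space fixed by the logical clocks form a line. -/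
theorem exists_vacuum (hcard : Nat.card H * d ^ m = d ^ n) :
    ∃ w ∈ fixedSpace H, ‖w‖ = 1 ∧ (∀ y, (F.clock y).1 w = w) ∧
      ∀ u ∈ fixedSpace H, (∀ y, (F.clock y).1 u = u) → ∃ c : ℂ, u = c • w := by
  obtain ⟨G, hG, hGs, hGc⟩ := F.exists_maximal
  have h1 := finrank_fixedSpace_mul_card hζ hGs
  rw [hGc, hcard] at h1
  have h2 : finrank ℂ (fixedSpace G) = 1 :=
    Nat.eq_of_mul_eq_mul_right (pow_pos (NeZero.pos d) n) (by rw [h1, one_mul])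
  obtain ⟨w₀, hw0, hw⟩ := finrank_eq_one_iff'.1 h2
  have hw0' : w₀.1 ≠ 0 := fun h => hw0 (Subtype.ext h)
  have hn : (‖w₀.1‖ : ℂ) ≠ 0 := by simpa using hw0'
  have hHG (h) (hh : h ∈ H) : h ∈ G := (hG h).2 ⟨h, hh, 1, by simp⟩
  have hCG (y) : F.clock y ∈ G := (hG _).2 ⟨1, one_mem _, y, one_mul _⟩
  have hmem : (‖w₀.1‖ : ℂ)⁻¹ • w₀.1 ∈ fixedSpace G := Submodule.smul_mem _ _ w₀.2
  refine ⟨(‖w₀.1‖ : ℂ)⁻¹ • w₀.1, fun h hh => hmem h (hHG h hh), ?_, fun y => hmem _ (hCG y),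
    fun u hu hu' => ?_⟩
  · rw [norm_smul, norm_inv, Complex.norm_real, norm_norm]
    exact inv_mul_cancel₀ (norm_ne_zero_iff.2 hw0')
  · have huG : u ∈ fixedSpace G := by
      intro g hg
      obtain ⟨h, hh, y, rfl⟩ := (hG g).1 hg
      change h.1 ((F.clock y).1 u) = u
      rw [hu' y, hu h hh]
    obtain ⟨c, hc⟩ := hw ⟨u, huG⟩
    refine ⟨c * ‖w₀.1‖, ?_⟩
    rw [smul_smul, mul_assoc, mul_inv_cancel₀ hn, mul_one]
    exact (congrArg Subtype.val hc).symm

theorem shift_apply_mem {w : QuditSpace d n} (hw : w ∈ fixedSpace H) (y) :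
    (F.shift y).1 w ∈ fixedSpace H := by
  intro h hh
  rw [apply_apply_eq_smul hζ, F.shift_commute h hh, hw h hh]
  simp

/-- If `p j ≠ q j`, the two vectors are eigenvectors of the unitary `j`-th clock with distinct
eigenvalues. -/
theorem orthonormal_shift {w : QuditSpace d n} (hw : ‖w‖ = 1)
    (hc : ∀ y, (F.clock y).1 w = w) :
    Orthonormal ℂ fun p : Fin m → ZMod d => (F.shift (.ofAdd p)).1 w := by
  rw [orthonormal_iff_ite]
  intro p q
  split_ifs with hpq
  · subst hpq
    rw [inner_pauli hζ, inner_self_eq_norm_sq_to_K, hw]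
    simp
  · obtain ⟨j, hj⟩ := Function.ne_iff.1 hpq
    have h1 (p : Fin m → ZMod d) : (F.clock (.ofAdd (Pi.single j 1))).1 ((F.shift (.ofAdd p)).1 w) =
        (zetaChar hζ (p j) : ℂ) • (F.shift (.ofAdd p)).1 w := by
      rw [F.clock_apply_shift_apply, hc, single_dotProduct, one_mul]
    have h2 := inner_pauli hζ (F.clock (.ofAdd (Pi.single j 1)))
      ((F.shift (.ofAdd p)).1 w) ((F.shift (.ofAdd q)).1 w)
    rw [h1, h1, inner_smul_left, inner_smul_right] at h2
    by_contra hI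
    have h3 : conj (zetaChar hζ (p j) : ℂ) * (zetaChar hζ (q j) : ℂ) = 1 :=
      mul_right_cancel₀ hI (by rw [one_mul, mul_assoc, h2])
    have h4 : (zetaChar hζ (p j) : ℂ) * conj (zetaChar hζ (p j) : ℂ) = 1 := by
      rw [Complex.mul_conj', norm_zetaChar]; simp
    have h5 : (zetaChar hζ (p j) : ℂ) = zetaChar hζ (q j) := by
      linear_combination (zetaChar hζ (q j) : ℂ) * h4 - (zetaChar hζ (p j) : ℂ) * h3
    refine hj (sub_eq_zero.1 (zetaChar_eq_one hζ _ ?_))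
    rw [AddChar.map_sub_eq_div, Units.ext h5, div_self']

include F in
/-- A frame identifies the protected space with the space of `m` qudits, compatibly with the
logical operators, and the normaliser acts by Pauli operators. -/
theorem exists_decoding (hH : H ⊓ Subgroup.zpowers (pauliScalar d n ζ) = ⊥)
    (hcard : Nat.card H * d ^ m = d ^ n) :
    ∃ e : fixedSpace H ≃ₗᵢ[ℂ] QuditSpace d m,
      (∀ g ∈ Subgroup.normalizer (H : Set (pauliGroup d n ζ)), ∃ (c : ℤ) (x : Phase d m),
        ∀ v v' : fixedSpace H, v'.1 = g.1 v.1 →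
          e v' = weylOp (zetaChar hζ) (ζ ^ c) x.1 x.2 (e v)) ∧
      ∀ (c : ℤ) (x : Phase d m), ∃ g ∈ Subgroup.normalizer (H : Set (pauliGroup d n ζ)),
        ∀ v v' : fixedSpace H, v'.1 = g.1 v.1 →
          e v' = weylOp (zetaChar hζ) (ζ ^ c) x.1 x.2 (e v) := by
  obtain ⟨w, hwH, hw1, hwc, hwu⟩ := F.exists_vacuum hcard
  let b (p : Fin m → ZMod d) : fixedSpace H :=
    ⟨(F.shift (.ofAdd p)).1 w, F.shift_apply_mem hwH _⟩
  have hb : Orthonormal ℂ b := (fixedSpace H).subtypeₗᵢ.orthonormal_comp_iff.1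
    (F.orthonormal_shift hw1 hwc)
  have hdim : finrank ℂ (fixedSpace H) = d ^ m := by
    have h1 := finrank_fixedSpace_mul_card hζ hH
    have hpos : 0 < Nat.card H := by
      have := finite_of_inf_eq_bot hζ hH
      exact Nat.card_pos
    exact Nat.eq_of_mul_eq_mul_right hpos (by rw [h1, ← hcard, mul_comm])
  let B : Basis (Fin m → ZMod d) ℂ (fixedSpace H) :=
    basisOfLinearIndependentOfCardEqFinrank hb.linearIndependent (by simp [hdim, ZMod.card])
  have hB (p) : B p = b p := by simp [B]
  let e : fixedSpace H ≃ₗᵢ[ℂ] QuditSpace d m :=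
    (B.toOrthonormalBasis (by rwa [coe_basisOfLinearIndependentOfCardEqFinrank])).equiv
      ((compBasis d m).toOrthonormalBasis compBasis_orthonormal) (Equiv.refl _)
  have he (p) : e (b p) = compBasis d m p := by
    have h1 := OrthonormalBasis.equiv_apply_basis
      (B.toOrthonormalBasis (by rwa [coe_basisOfLinearIndependentOfCardEqFinrank]))
      ((compBasis d m).toOrthonormalBasis compBasis_orthonormal) (Equiv.refl _) p
    simpa [hB] using h1
  have key (g : pauliGroup d n ζ) (c : ℤ) (x : Phase d m)
      (h : ∀ p, g.1 (b p).1 = ((ζ ^ c * zetaChar hζ (x.2 ⬝ᵥ p) : ℂˣ) : ℂ) • (b (p + x.1)).1)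
      (v v' : fixedSpace H) (hv : v'.1 = g.1 v.1) :
      e v' = weylOp (zetaChar hζ) (ζ ^ c) x.1 x.2 (e v) := by
    have h1 : (fixedSpace H).subtype ∘ₗ e.symm.toLinearEquiv.toLinearMap ∘ₗ
        (weylOp (zetaChar hζ) (ζ ^ c) x.1 x.2).toLinearMap ∘ₗ e.toLinearEquiv.toLinearMap =
        g.1.toLinearMap ∘ₗ (fixedSpace H).subtype := by
      refine B.ext fun p => ?_
      change (e.symm (weylOp _ _ _ _ (e (B p)))).1 = g.1 (B p).1
      rw [hB, he, weylOp_compBasis, map_smul, ← he, e.symm_apply_apply, h]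
      rfl
    have h2 := LinearMap.congr_fun h1 v
    have h3 : e.symm (weylOp (zetaChar hζ) (ζ ^ c) x.1 x.2 (e v)) = v' :=
      Subtype.ext (h2.trans hv.symm)
    rw [← h3, LinearIsometryEquiv.apply_symm_apply]
  have hact (x : Phase d m) (p) : (F.shift (.ofAdd x.1) * F.clock (.ofAdd x.2)).1 (b p).1 =
      (zetaChar hζ (x.2 ⬝ᵥ p) : ℂ) • (b (p + x.1)).1 := by
    change (F.shift _).1 ((F.clock _).1 ((F.shift _).1 w)) = _
    rw [F.clock_apply_shift_apply, hwc, map_smul]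
    congr 1
    rw [add_comm]
    change _ = (F.shift (.ofAdd (x.1 + p))).1 w
    rw [ofAdd_add, map_mul]
    rfl
  refine ⟨e, fun g hg => ?_, fun c x => ?_⟩
  · have hgH := (mem_normalizer_iff_symp hζ hH).1 hg
    -- The logical symbol of `g` is read off from its commutation with the clocks and the shifts.
    let x : Phase d m :=
      (fun j => symp d n (symb hζ (F.clock (.ofAdd (Pi.single j 1)))) (symb hζ g),
        fun j => symp d n (symb hζ g) (symb hζ (F.shift (.ofAdd (Pi.single j 1)))))
    have hx1 (y) : symp d n (symb hζ (F.clock (.ofAdd y))) (symb hζ g) = y ⬝ᵥ x.1 := by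
      rw [symb_hom]
      simp [dotProduct, x]
    have hx2 (y) : symp d n (symb hζ g) (symb hζ (F.shift (.ofAdd y))) = x.2 ⬝ᵥ y := by
      rw [symb_hom]
      simp [dotProduct, x, mul_comm]
    have hcc (y z) : symp d n (symb hζ (F.clock y)) (symb hζ (F.clock z)) = 0 := by
      rw [← mul_comm_iff, ← map_mul, mul_comm, map_mul]
    have hss (y z) : symp d n (symb hζ (F.shift y)) (symb hζ (F.shift z)) = 0 := by
      rw [← mul_comm_iff, ← map_mul, mul_comm, map_mul]
    set q := F.shift (.ofAdd x.1) * F.clock (.ofAdd x.2) with hq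
    -- The quotient `r` of `g` by its logical model commutes with `H`, the clocks and the shifts. It
    -- therefore preserves the line of `w` and acts on all of `V^H` by one scalar `s`.
    obtain ⟨r, hr⟩ : ∃ r, r = q⁻¹ * g := ⟨_, rfl⟩
    have hrs : symb hζ r = -(symb hζ (F.shift (.ofAdd x.1)) + symb hζ (F.clock (.ofAdd x.2))) +
        symb hζ g := by rw [hr, symb_mul, symb_inv, hq, symb_mul]
    have hrc (y) : symp d n (symb hζ (F.clock y)) (symb hζ r) = 0 := by
      rw [← ofAdd_toAdd y, hrs, map_add, map_neg, map_add, hcc, F.clock_shift, hx1]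
      simp
    have hrsh (y) : symp d n (symb hζ r) (symb hζ (F.shift y)) = 0 := by
      obtain ⟨y, rfl⟩ := Multiplicative.ofAdd.surjective y
      rw [hrs]
      simp [hss, F.clock_shift, hx2]
    have hrH (h) (hh : h ∈ H) : symp d n (symb hζ h) (symb hζ r) = 0 := by
      rw [hrs]
      simp [F.shift_commute h hh, F.clock_commute h hh, symp_comm_eq_zero (hgH h hh)]
    obtain ⟨s, hs⟩ := hwu (r.1 w)
      (fun h hh => by rw [apply_apply_eq_smul hζ, hrH h hh, hwH h hh]; simp)
      fun y => by rw [apply_apply_eq_smul hζ, hrc, hwc]; simp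
    have hpow (t : ℕ) : (r ^ t).1 w = s ^ t • w := by
      induction t with
      | zero => simp
      | succ t ih =>
        rw [pow_succ, Subgroup.coe_mul, LinearEquiv.mul_apply, hs, map_smul, ih, smul_smul,
          pow_succ']
    have hw0 : w ≠ 0 := fun h => by simp [h] at hw1
    -- This makes `s` a power of `ζ`, so that the action stays within the Pauli group.
    have hs1 : s ^ dbar d = 1 := by
      have h1 := hpow (dbar d)
      rw [pow_dbar_eq_one hζ] at h1
      exact smul_left_injective ℂ hw0 (h1.symm.trans (one_smul ℂ w).symm)
    have : NeZero (dbar d) := ⟨dbar_pos.ne'⟩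
    obtain ⟨c, -, hc⟩ := hζ.eq_pow_of_pow_eq_one hs1
    refine ⟨c, x, key g c x fun p => ?_⟩
    have h1 : r.1 (b p).1 = s • (b p).1 := by
      change r.1 ((F.shift _).1 w) = s • (F.shift _).1 w
      rw [apply_apply_eq_smul hζ, hrsh, hs]
      simp
    have h2 : g.1 (b p).1 = q.1 (r.1 (b p).1) := by
      have : g = q * r := by rw [hr, mul_inv_cancel_left]
      rw [this]
      rfl
    rw [h2, h1, map_smul, hact, smul_smul, ← hc]
    simp
  · refine ⟨pauliScalar d n ζ ^ c * (F.shift (.ofAdd x.1) * F.clock (.ofAdd x.2)), ?_,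
      key _ c x fun p => ?_⟩
    · rw [mem_normalizer_iff_symp hζ hH]
      intro h hh
      rw [symb_mul, symb_mul, (symb_eq_zero_iff hζ _).2 (Subgroup.mem_zpowers_iff.2 ⟨c, rfl⟩)]
      simp [symp_comm_eq_zero (F.clock_commute h hh _), symp_comm_eq_zero (F.shift_commute h hh _)]
    · change (pauliScalar d n ζ ^ c : pauliGroup d n ζ).1 ((F.shift _ * F.clock _).1 _) = _
      rw [hact, coe_pauliScalar_zpow, Units.val_mul, mul_smul]
      rfl

end LogicalFrame
end Logical

/-! ### The intertwining isomorphisms -/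

/-- A logical frame yields the intertwining pair of a unitary isomorphism and a group
isomorphism. -/
theorem exists_intertwiner {d n m : ℕ} [NeZero d] {ζ : ℂˣ}
    (hζ : IsPrimitiveRoot (ζ : ℂ) (dbar d)) {H : Subgroup (pauliGroup d n ζ)}
    (hH : H ⊓ Subgroup.zpowers (pauliScalar d n ζ) = ⊥) (F : LogicalFrame hζ H m)
    (hcard : Nat.card H * d ^ m = d ^ n) :
    ∃ (e : fixedSpace H ≃ₗᵢ[ℂ] QuditSpace d m)
      (f : NormalizerQuotient H ≃* pauliGroup d m ζ),
      ∀ (g : NormalizerQuotient H) (v : fixedSpace H), e (quotientAction H g v) = (f g).1 (e v) := by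
  obtain ⟨e, h1, h2⟩ := F.exists_decoding hH hcard
  let ρ : NormalizerQuotient H →* (QuditSpace d m ≃ₗ[ℂ] QuditSpace d m) :=
    { toFun := fun g => e.symm.toLinearEquiv ≪≫ₗ
        LinearEquiv.ofLinearMap (quotientAction H g) (quotientAction H g⁻¹)
          (by rw [← Module.End.mul_eq_comp, ← map_mul]; simp; rfl)
          (by rw [← Module.End.mul_eq_comp, ← map_mul]; simp; rfl) ≪≫ₗ e.toLinearEquiv
      map_one' := LinearEquiv.ext fun v => by simp
      map_mul' := fun g h => LinearEquiv.ext fun v => by simp }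
  have hρ (g v) : ρ g (e v) = e (quotientAction H g v) := by
    change e (quotientAction H g (e.symm (e v))) = _
    rw [e.symm_apply_apply]
  have hmem (g) : ρ g ∈ pauliGroup d m ζ := by
    obtain ⟨g, rfl⟩ := QuotientGroup.mk_surjective g
    obtain ⟨c, x, hx⟩ := h1 g.1 g.2
    have : ρ (QuotientGroup.mk g) = weylOp (zetaChar hζ) (ζ ^ c) x.1 x.2 := by
      refine LinearEquiv.ext fun u => ?_
      obtain ⟨v, rfl⟩ := e.surjective u
      rw [hρ]
      exact hx v _ (quotientAction_mk H g v)
    rw [this]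
    exact weylOp_mem hζ c x
  have hbij : Function.Bijective (ρ.codRestrict _ hmem) := by
    constructor
    · rw [injective_iff_map_eq_one]
      intro g hg
      obtain ⟨g, rfl⟩ := QuotientGroup.mk_surjective g
      rw [QuotientGroup.eq_one_iff, Subgroup.mem_subgroupOf]
      refine mem_of_forall_apply_eq hζ hH fun v hv => ?_
      have h3 := hρ (QuotientGroup.mk g) ⟨v, hv⟩
      have h4 : ρ (QuotientGroup.mk g) = 1 := congrArg Subtype.val hg
      rw [h4] at h3
      exact congrArg Subtype.val (e.injective h3).symm
    · rintro ⟨q, hq⟩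
      obtain ⟨c, x, rfl⟩ := exists_eq_weylOp hζ hq
      obtain ⟨g, hg, hx⟩ := h2 c x
      refine ⟨QuotientGroup.mk ⟨g, hg⟩, Subtype.ext (LinearEquiv.ext fun u => ?_)⟩
      obtain ⟨v, rfl⟩ := e.surjective u
      exact (hρ _ v).trans (hx v _ (quotientAction_mk H ⟨g, hg⟩ v))
  exact ⟨e, MulEquiv.ofBijective _ hbij, fun g v => (hρ g v).symm⟩

end QuditPauli

end

theorem mainTheorem2 (d n k : ℕ) [NeZero d] (hd : 2 ≤ d)
    (ζ : ℂˣ) (hζ : IsPrimitiveRoot (ζ : ℂ) (QuditPauli.dbar d))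
    (H : Subgroup (QuditPauli.pauliGroup d n ζ))
    (hcomm : ∀ x ∈ H, ∀ y ∈ H, x * y = y * x)
    (hscalar : H ⊓ Subgroup.zpowers (QuditPauli.pauliScalar d n ζ) = ⊥)
    (hfree : Nonempty (Additive H ≃+ (Fin k → ZMod d))) :
    k ≤ n ∧
      ∃ (e : QuditPauli.fixedSpace H ≃ₗᵢ[ℂ] QuditPauli.QuditSpace d (n - k))
        (f : QuditPauli.NormalizerQuotient H ≃* QuditPauli.pauliGroup d (n - k) ζ),
        ∀ (g : QuditPauli.NormalizerQuotient H) (v : QuditPauli.fixedSpace H),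
          e (QuditPauli.quotientAction H g v) = (f g).1 (e v) := by
  obtain ⟨φ⟩ := hfree
  have hcard : Nat.card H = d ^ k := by
    rw [Nat.card_congr (Additive.ofMul.trans φ.toEquiv), Nat.card_eq_fintype_card]
    simp [ZMod.card]
  -- The dimension formula gives `d ^ k ∣ d ^ n`.
  have hkn : k ≤ n := by
    have h1 := QuditPauli.finrank_fixedSpace_mul_card hζ hscalar
    rw [hcard] at h1
    exact (Nat.pow_dvd_pow_iff_le_right (by omega)).1 (Dvd.intro_left _ h1)
  obtain ⟨F⟩ := QuditPauli.exists_logicalFrame (m := n - k) hζ hscalar φ (by omega)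
  refine ⟨hkn, QuditPauli.exists_intertwiner hζ hscalar F ?_⟩
  rw [hcard, ← pow_add, Nat.add_sub_cancel' hkn]
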